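/- Let $\alpha>0$ and, for $t>0$, let $w(x,t)=(1-x^2)^{\alpha}\,e^{-t/(1-x^2)}$, $x\in[-1,1]$ (with $w(\pm1,t)=0$). Let $\mu_k(t)=\int_{-1}^{1}x^k w(x,t)\,dx$ for $k\ge 0$, and let $$D_n(t)=\det\big(\mu_{i+j}(t)\big)_{i,j=0}^{n-1}\quad(D_0=1),\qquad \sigma_n(t)=2t\,\frac{d}{dt}\ln D_n(t),\qquad n=0,1,2,\dots$$ Then, for every $n\ge 0$, $D_n$ is positive and differentiable on $(0,\infty)$, the function $\sigma_n$ is twice differentiable on $(0,\infty)$, and for all $t>0$ (with $\sigma_n,\sigma_n',\sigma_n''$ evaluated at $t$, $'=d/dt$) $$ \begin{aligned} &\Big\{t^4(\sigma_n'')^2+2t^2\big[(n+\alpha)^2+t(\alpha-\sigma_n')\big]\sigma_n''+2t^3(\sigma_n')^3-t^2\big[(t+\alpha)^2-3n(n+2\alpha)-1+4\sigma_n\big](\sigma_n')^2\\ &\ -2t\big[3n^4+12n^3\alpha+n^2(t^2+4t\alpha+15\alpha^2+2)+2n\alpha(t^2+4t\alpha+3\alpha^2+2)+\alpha(t+2\alpha)\big]\sigma_n'\\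 &\ +2t\big[3(n+\alpha)^2+t(t+4\alpha)\big]\sigma_n\sigma_n'\\ &\ -\big[2n^4+8n^3\alpha+2n^2(t^2+3t\alpha+6\alpha^2)+4n\alpha(t+\alpha)(t+2\alpha)+2\alpha(t+\alpha)^3\big]\sigma_n\\ &\ +2n^6+12n^5\alpha+2(t^2+3t\alpha+14\alpha^2+1)n^4+8n^3\alpha(t^2+3t\alpha+4\alpha^2+1)\\ &\ +n^2\big[2t^3\alpha+(14\alpha^2+1)t^2+2t\alpha(15\alpha^2+2)+6\alpha^2(3\alpha^2+2)\big]\\ &\ +n\big[4t^3\alpha^2+2t^2\alpha(6\alpha^2+1)+4t\alpha^2(3\alpha^2+2)+4\alpha^3(\alpha^2+2)\big]+2\alpha^2(t+\alpha)^2\Big\}^2\\ &=4(n+\alpha)^2\big[(n+\alpha)^2+t(t+2\alpha)-2t\sigma_n'\big]\\ &\ \times\Big\{t^2\sigma_n''-t(2n^2+4n\alpha+1-2\sigma_n)\sigma_n'-\big[(n+\alpha)^2+t(t+2\alpha)\big]\sigma_n+n^4+4n^3\alpha+\alpha(t+\alpha)\\ &\qquad+n^2(t^2+2t\alpha+5\alpha^2+1)+2n\alpha\big[(t+\alpha)^2+1\big]\Big\}^2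 . \end{aligned} $$ Moreover, for every $n\ge 1$ and all $t>0$, $$ \begin{aligned} &\Big\{\big[n(n+2\alpha-2t)-\sigma_n\big]f_n-2nt(2n-1+2\alpha)(2n+1+2\alpha)\Big\}^2\\ &\ +4t(n+\alpha)\,g_n\Big\{\big[n(n+2\alpha-2t)-\sigma_n\big]f_n-2nt(2n-1+2\alpha)(2n+1+2\alpha)\Big\}\\ &\ -4(n+\alpha)^2(\sigma_{n-1}-\sigma_n)(\sigma_n-\sigma_{n+1})(n^2+2n\alpha-\sigma_n)\,g_n=0, \end{aligned} $$ where $$f_n=(2n+1+2\alpha)\sigma_{n-1}-(2n-1+2\alpha)\sigma_{n+1}-\sigma_{n-1}\sigma_{n+1}-\sigma_n^2+\sigma_n(\sigma_{n-1}+\sigma_{n+1}-2),$$ $$g_n=(2n-1+2\alpha+\sigma_{n-1}-\sigma_n)(2n+1+2\alpha+\sigma_n-\sigma_{n+1}).$$ -/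

import Mathlib

open MeasureTheory

namespace PollaczekJacobi

noncomputable section

/-- The weight `w(x,t) = (1 - x²)^α exp(-t / (1 - x²))` on `[-1,1]`. For `α > 0` the value at the
endpoints `x = 1` and `x = -1` is `0`, the continuous extension. -/
def weight (α t x : ℝ) : ℝ :=
  (1 - x ^ 2) ^ α * Real.exp (-t / (1 - x ^ 2))

/-- The moments `μ_k(t) = ∫_{-1}^{1} x^k w(x,t) dx`. -/
def moment (α : ℝ) (k : ℕ) (t : ℝ) : ℝ :=
  ∫ x in (-1 : ℝ)..1, x ^ k * weight α t x

/-- The Hankel determinant `D_n(t) = det (μ_{i+j}(t))`, `0 ≤ i, j ≤ n - 1` (so `D_0 = 1`). -/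
def hankelDet (α : ℝ) (n : ℕ) (t : ℝ) : ℝ :=
  Matrix.det (Matrix.of fun i j : Fin n => moment α ((i : ℕ) + (j : ℕ)) t)

/-- `σ_n(t) = 2 t (d/dt) ln D_n(t)`. -/
def sigma (α : ℝ) (n : ℕ) (t : ℝ) : ℝ :=
  2 * t * deriv (fun τ => Real.log (hankelDet α n τ)) t

/-- The second-order differential equation, as a relation between `n`, `α`, `t` and the values
`s`, `s₁`, `s₂` of `σ_n`, `σ_n'`, `σ_n''` at `t`. -/
def SatisfiesODE (n α t s s₁ s₂ : ℝ) : Prop :=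
  (t ^ 4 * s₂ ^ 2
      + 2 * t ^ 2 * ((n + α) ^ 2 + t * (α - s₁)) * s₂
      + 2 * t ^ 3 * s₁ ^ 3
      - t ^ 2 * ((t + α) ^ 2 - 3 * n * (n + 2 * α) - 1 + 4 * s) * s₁ ^ 2
      - 2 * t * (3 * n ^ 4 + 12 * n ^ 3 * α
          + n ^ 2 * (t ^ 2 + 4 * t * α + 15 * α ^ 2 + 2)
          + 2 * n * α * (t ^ 2 + 4 * t * α + 3 * α ^ 2 + 2)
          + α * (t + 2 * α)) * s₁
      + 2 * t * (3 * (n + α) ^ 2 + t * (t + 4 * α)) * s * s₁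
      - (2 * n ^ 4 + 8 * n ^ 3 * α
          + 2 * n ^ 2 * (t ^ 2 + 3 * t * α + 6 * α ^ 2)
          + 4 * n * α * (t + α) * (t + 2 * α)
          + 2 * α * (t + α) ^ 3) * s
      + 2 * n ^ 6 + 12 * n ^ 5 * α
      + 2 * (t ^ 2 + 3 * t * α + 14 * α ^ 2 + 1) * n ^ 4
      + 8 * n ^ 3 * α * (t ^ 2 + 3 * t * α + 4 * α ^ 2 + 1)
      + n ^ 2 * (2 * t ^ 3 * α + (14 * α ^ 2 + 1) * t ^ 2
          + 2 * t * α * (15 * α ^ 2 + 2) + 6 * α ^ 2 * (3 * α ^ 2 + 2))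
      + n * (4 * t ^ 3 * α ^ 2 + 2 * t ^ 2 * α * (6 * α ^ 2 + 1)
          + 4 * t * α ^ 2 * (3 * α ^ 2 + 2) + 4 * α ^ 3 * (α ^ 2 + 2))
      + 2 * α ^ 2 * (t + α) ^ 2) ^ 2
  = 4 * (n + α) ^ 2 * ((n + α) ^ 2 + t * (t + 2 * α) - 2 * t * s₁)
    * (t ^ 2 * s₂
      - t * (2 * n ^ 2 + 4 * n * α + 1 - 2 * s) * s₁
      - ((n + α) ^ 2 + t * (t + 2 * α)) * s
      + n ^ 4 + 4 * n ^ 3 * α + α * (t + α)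
      + n ^ 2 * (t ^ 2 + 2 * t * α + 5 * α ^ 2 + 1)
      + 2 * n * α * ((t + α) ^ 2 + 1)) ^ 2

/-- `f(σ_n, σ_{n±1})`, with `a`, `b`, `c` standing for `σ_{n-1}`, `σ_n`, `σ_{n+1}`. -/
def diffF (n α a b c : ℝ) : ℝ :=
  (2 * n + 1 + 2 * α) * a - (2 * n - 1 + 2 * α) * c - a * c - b ^ 2 + b * (a + c - 2)

/-- `g(σ_n, σ_{n±1})`, with `a`, `b`, `c` standing for `σ_{n-1}`, `σ_n`, `σ_{n+1}`. -/
def diffG (n α a b c : ℝ) : ℝ :=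
  (2 * n - 1 + 2 * α + a - b) * (2 * n + 1 + 2 * α + b - c)

/-- The second-order difference equation, as a relation between `n`, `α`, `t` and the values
`a`, `b`, `c` of `σ_{n-1}`, `σ_n`, `σ_{n+1}` at `t`. -/
def SatisfiesDifferenceEq (n α t a b c : ℝ) : Prop :=
  ((n * (n + 2 * α - 2 * t) - b) * diffF n α a b c
      - 2 * n * t * (2 * n - 1 + 2 * α) * (2 * n + 1 + 2 * α)) ^ 2
    + 4 * t * (n + α) * diffG n α a b c
      * ((n * (n + 2 * α - 2 * t) - b) * diffF n α a b c
        - 2 * n * t * (2 * n - 1 + 2 * α) * (2 * n + 1 + 2 * α))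
    - 4 * (n + α) ^ 2 * (a - b) * (b - c) * (n ^ 2 + 2 * n * α - b) * diffG n α a b c
  = 0

end

end PollaczekJacobi

/-! The weight is even and `w'/w` is rational, so everything reduces to algebra about its monic
orthogonal polynomials `P_n`, with norms `h_n` and recurrence coefficients `β_n`. Let `L` and `K`
denote integration against `w` and `w/(1-x²)`. Since `∂w/∂t = -w/(1-x²)`, differentiating `L` in `t`
gives `-K`, so `h_n' = -K(P_n²)`. As `D_n = h_0 ⋯ h_{n-1}` (`hankelDet_eq_prod`), `σ_n = -(x_0 + ⋯ +
x_{n-1})` with `x_n = 2t K(P_n²)/h_n`.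

One more unknown is needed, `ρ_n = 2t K(X P_n P_{n-1})/h_{n-1}`. The recurrence gives `ρ_{n+1} ±
ρ_n` in terms of `x` and `β`, and integration by parts gives `ρ_n` in terms of `β_n` and the
subleading coefficient of `P_n` (`auxR_eq`). These relations telescope in `n` to three algebraic
identities between `β_n`, `ρ_n`, `x_n`, `x_{n-1}` and `σ_n` (`compatibility`). Since `x_{n-1}` and
`x_n` are differences of consecutive `σ`, eliminating `β_n` and `ρ_n` yields the difference
equation.

For the differential equation, Toda-type formulas for the `t`-derivatives of `β_n` and the
subleading coefficient give `ρ_n'` and `σ_n'`. The outcome is a quadratic equation for `ρ_n` over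
`σ_n'`, and a relation between `ρ_n`, `ρ_n'` and `σ_n`. Eliminating `ρ_n` introduces a square root,
which explains the squared form of the equation (`satisfiesODE_of_relations`). -/

namespace PollaczekJacobi

noncomputable section

open Polynomial

/-! ### Monic polynomials of an even functional. -/

/-- The monic polynomials generated by the three-term recurrence of an even functional `L`. -/
def orthoPoly (L : ℝ[X] →ₗ[ℝ] ℝ) : ℕ → ℝ[X]
  | 0 => 1
  | 1 => X
  | n + 2 => X * orthoPoly L (n + 1)
      - C (L (orthoPoly L (n + 1) ^ 2) / L (orthoPoly L n ^ 2)) * orthoPoly L n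

/-- The squared norm `L (P_n²)`. -/
def sqNorm (L : ℝ[X] →ₗ[ℝ] ℝ) (n : ℕ) : ℝ := L (orthoPoly L n ^ 2)

/-- The recurrence coefficients `β_n`, with `β_0 = 0`. -/
def recCoeff (L : ℝ[X] →ₗ[ℝ] ℝ) : ℕ → ℝ
  | 0 => 0
  | n + 1 => sqNorm L (n + 1) / sqNorm L n

/-- The coefficient of `X ^ (n - 2)` in `P_n`. -/
def subCoeff (L : ℝ[X] →ₗ[ℝ] ℝ) (n : ℕ) : ℝ := -∑ j ∈ Finset.range n, recCoeff L j

lemma subCoeff_succ (L : ℝ[X] →ₗ[ℝ] ℝ) (n : ℕ) :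
    subCoeff L (n + 1) = subCoeff L n - recCoeff L n := by
  simp only [subCoeff, Finset.sum_range_succ]; ring

section Recurrence

variable (L : ℝ[X] →ₗ[ℝ] ℝ)

lemma orthoPoly_add_two (n : ℕ) : orthoPoly L (n + 2) =
    X * orthoPoly L (n + 1) - C (recCoeff L (n + 1)) * orthoPoly L n := rfl

lemma X_mul_orthoPoly_succ (n : ℕ) : X * orthoPoly L (n + 1) =
    orthoPoly L (n + 2) + C (recCoeff L (n + 1)) * orthoPoly L n := by
  rw [orthoPoly_add_two]; ring

lemma orthoPoly_comp_neg_X (n : ℕ) :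
    (orthoPoly L n).comp (-X) = (-1) ^ n * orthoPoly L n := by
  induction n using Nat.twoStepInduction with
  | zero => simp [orthoPoly]
  | one => simp [orthoPoly]
  | more n h0 h1 =>
    rw [orthoPoly_add_two]
    simp only [sub_comp, mul_comp, X_comp, C_comp, h0, h1]
    ring

lemma natDegree_orthoPoly_le (n : ℕ) : (orthoPoly L n).natDegree ≤ n := by
  induction n using Nat.twoStepInduction with
  | zero => simp [orthoPoly]
  | one => simp [orthoPoly]
  | more n h0 h1 =>
    rw [orthoPoly_add_two]
    refine (natDegree_sub_le _ _).trans (max_le ?_ ?_)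
    · exact (natDegree_mul_le).trans (by rw [natDegree_X]; omega)
    · exact (natDegree_C_mul_le _ _).trans (by omega)

lemma coeff_orthoPoly_of_lt {n k : ℕ} (h : n < k) : (orthoPoly L n).coeff k = 0 :=
  coeff_eq_zero_of_natDegree_lt ((natDegree_orthoPoly_le L n).trans_lt h)

lemma coeff_orthoPoly_self (n : ℕ) : (orthoPoly L n).coeff n = 1 := by
  induction n using Nat.twoStepInduction with
  | zero => simp [orthoPoly]
  | one => simp [orthoPoly]
  | more n h0 h1 =>
    rw [orthoPoly_add_two, coeff_sub, coeff_X_mul, coeff_C_mul, h1,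
      coeff_orthoPoly_of_lt L (by omega)]
    simp

lemma orthoPoly_ne_zero (n : ℕ) : orthoPoly L n ≠ 0 := fun h => by
  simpa [h] using coeff_orthoPoly_self L n

lemma coeff_orthoPoly_succ (n : ℕ) : (orthoPoly L (n + 1)).coeff n = 0 := by
  induction n with
  | zero => simp [orthoPoly]
  | succ n ih =>
    rw [orthoPoly_add_two, coeff_sub, coeff_X_mul, coeff_C_mul, ih,
      coeff_orthoPoly_of_lt L (by omega)]
    simp

lemma coeff_orthoPoly_add_two (n : ℕ) :
    (orthoPoly L (n + 2)).coeff n = subCoeff L (n + 2) := by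
  induction n with
  | zero =>
    rw [orthoPoly_add_two]
    simp [subCoeff, Finset.sum_range_succ, recCoeff, orthoPoly]
  | succ n ih =>
    rw [orthoPoly_add_two, coeff_sub, coeff_X_mul, coeff_C_mul, ih, coeff_orthoPoly_self,
      subCoeff_succ L (n + 2)]
    ring

end Recurrence

/-! ### Semiclassical functionals and orthogonality. -/

/-- A pair of functionals `L p = ∫ p w`, `K p = ∫ p w / (1 - x²)` on polynomials, for a weight `w`
which satisfies `(1 - x²)² w' = -(2 α x (1 - x²) + 2 t x) w`. -/
structure IsSemiclassical (α t : ℝ) (L K : ℝ[X] →ₗ[ℝ] ℝ) : Prop where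
  even : ∀ p : ℝ[X], L (p.comp (-X)) = L p
  pos : ∀ p : ℝ[X], p ≠ 0 → 0 < L (p ^ 2)
  one_sub_sq : ∀ p : ℝ[X], K ((1 - X ^ 2) * p) = L p
  parts : ∀ q : ℝ[X], L ((1 - X ^ 2) * derivative q) =
    (2 + 2 * α) * L (X * q) + 2 * t * K (X * q)

lemma map_C_mul (L : ℝ[X] →ₗ[ℝ] ℝ) (a : ℝ) (p : ℝ[X]) : L (C a * p) = a * L p := by
  rw [← smul_eq_C_mul, map_smul, smul_eq_mul]

namespace IsSemiclassical

variable {α t : ℝ} {L K : ℝ[X] →ₗ[ℝ] ℝ} (S : IsSemiclassical α t L K)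

include S

lemma sqNorm_pos (n : ℕ) : 0 < sqNorm L n := S.pos _ (orthoPoly_ne_zero L n)

lemma recCoeff_succ_mul (n : ℕ) : recCoeff L (n + 1) * sqNorm L n = sqNorm L (n + 1) :=
  div_mul_cancel₀ _ (S.sqNorm_pos n).ne'

/-- The argument of `L` is odd. This is why the three-term recurrence has no diagonal coefficient.
-/
lemma X_mul_sq (n : ℕ) : L (X * orthoPoly L n ^ 2) = 0 := by
  have h := S.even (X * orthoPoly L n ^ 2)
  have e : (X * orthoPoly L n ^ 2).comp (-X) = -(X * orthoPoly L n ^ 2) := by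
    simp only [mul_comp, X_comp, pow_comp, orthoPoly_comp_neg_X]
    rw [mul_pow, ← pow_mul, mul_comm n 2, pow_mul]
    simp
  rw [e, map_neg] at h
  linarith

lemma orthogonal (n : ℕ) : ∀ k < n, L (orthoPoly L n * orthoPoly L k) = 0 := by
  induction n using Nat.twoStepInduction with
  | zero => simp
  | one =>
    intro k hk
    obtain rfl : k = 0 := by omega
    have := S.X_mul_sq 0
    simpa [orthoPoly] using this
  | more n h0 h1 =>
    intro k hk
    have e : L (orthoPoly L (n + 2) * orthoPoly L k) =
        L (orthoPoly L (n + 1) * (X * orthoPoly L k))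
          - recCoeff L (n + 1) * L (orthoPoly L n * orthoPoly L k) := by
      rw [orthoPoly_add_two, ← map_C_mul, ← map_sub]; congr 1; ring
    rw [e]
    rcases Nat.lt_trichotomy k n with h | h | h
    · rw [h0 k h]
      rcases k with _ | k
      · have := h1 1 (by omega)
        simp only [orthoPoly] at this ⊢
        simpa using this
      · rw [X_mul_orthoPoly_succ, mul_add, map_add, h1 (k + 2) (by omega),
          show orthoPoly L (n + 1) * (C (recCoeff L (k + 1)) * orthoPoly L k) =
            C (recCoeff L (k + 1)) * (orthoPoly L (n + 1) * orthoPoly L k) by ring,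
          map_C_mul, h1 k (by omega)]
        simp
    -- The case that determines `β`: it is chosen so that the two surviving norms cancel.
    · subst h
      rw [← sq, ← sqNorm, S.recCoeff_succ_mul, sub_eq_zero]
      rcases k with _ | k
      · simp [orthoPoly, sqNorm, sq]
      · rw [X_mul_orthoPoly_succ, mul_add, map_add, ← sq, ← sqNorm,
          show orthoPoly L (k + 2) * (C (recCoeff L (k + 1)) * orthoPoly L k) =
            C (recCoeff L (k + 1)) * (orthoPoly L (k + 2) * orthoPoly L k) by ring,
          map_C_mul, h1 k (by omega)]
        simp
    · obtain rfl : k = n + 1 := by omega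
      rw [mul_comm (orthoPoly L n), h1 n (by omega),
        show orthoPoly L (n + 1) * (X * orthoPoly L (n + 1)) = X * orthoPoly L (n + 1) ^ 2 by ring,
        S.X_mul_sq]
      simp

/-- Induction on `m`, removing the top coefficient of `q` with a multiple of `P_m`. -/
lemma map_orthoPoly_mul_of_lt (n m : ℕ) (hm : m ≤ n) :
    ∀ q : ℝ[X], q.degree < m → L (orthoPoly L n * q) = 0 := by
  induction m with
  | zero =>
    intro q hq
    have : q = 0 := by
      rw [← degree_eq_bot]
      by_contra h
      rw [degree_eq_natDegree (by simpa using h)] at hq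
      norm_cast at hq
    simp [this]
  | succ m ih =>
    intro q hq
    have h : L (orthoPoly L n * (q - C (q.coeff m) * orthoPoly L m)) = 0 := by
      refine ih (by omega) _ ?_
      rw [degree_lt_iff_coeff_zero]
      intro k hk
      rw [coeff_sub, coeff_C_mul]
      rcases hk.eq_or_lt with rfl | hk
      · rw [coeff_orthoPoly_self]; ring
      · rw [coeff_orthoPoly_of_lt L hk, (degree_lt_iff_coeff_zero q (m + 1)).1 hq k hk]; ring
    rw [mul_sub, map_sub, mul_left_comm, map_C_mul, S.orthogonal n m (by omega)] at h
    linarith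

/-- Subtracting `q_n P_n` from `q` leaves lower degree, so every `L`-value needed later is read off
from one coefficient. -/
lemma map_orthoPoly_mul (n : ℕ) (q : ℝ[X]) (hq : ∀ k, n < k → q.coeff k = 0) :
    L (orthoPoly L n * q) = q.coeff n * sqNorm L n := by
  have h : L (orthoPoly L n * (q - C (q.coeff n) * orthoPoly L n)) = 0 := by
    refine S.map_orthoPoly_mul_of_lt n n le_rfl _ ?_
    rw [degree_lt_iff_coeff_zero]
    intro k hk
    rw [coeff_sub, coeff_C_mul]
    rcases hk.eq_or_lt with rfl | hk
    · rw [coeff_orthoPoly_self]; ring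
    · rw [coeff_orthoPoly_of_lt L hk, hq k hk]; ring
  rw [mul_sub, map_sub, mul_left_comm, map_C_mul, ← sq, ← sqNorm] at h
  linarith

end IsSemiclassical

/-! ### The auxiliary quantities `x_n`, `ρ_n` and their linear relations. -/

/-- `x_n = 2 t K(P_n²) / h_n`. -/
def auxX (t : ℝ) (L K : ℝ[X] →ₗ[ℝ] ℝ) (n : ℕ) : ℝ :=
  2 * t * K (orthoPoly L n ^ 2) / sqNorm L n

/-- `ρ_n = 2 t K(X P_n P_{n-1}) / h_{n-1}`, with `ρ_0 = 0`. -/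
def auxR (t : ℝ) (L K : ℝ[X] →ₗ[ℝ] ℝ) : ℕ → ℝ
  | 0 => 0
  | n + 1 => 2 * t * K (X * orthoPoly L (n + 1) * orthoPoly L n) / sqNorm L n

namespace IsSemiclassical

variable {α t : ℝ} {L K : ℝ[X] →ₗ[ℝ] ℝ} (S : IsSemiclassical α t L K)

include S

lemma sqNorm_mul_auxX (n : ℕ) :
    sqNorm L n * auxX t L K n = 2 * t * K (orthoPoly L n ^ 2) := by
  rw [auxX, mul_div_cancel₀ _ (S.sqNorm_pos n).ne']

lemma sqNorm_mul_auxR (n : ℕ) : sqNorm L n * auxR t L K (n + 1) =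
    2 * t * K (X * orthoPoly L (n + 1) * orthoPoly L n) := by
  rw [auxR, mul_div_cancel₀ _ (S.sqNorm_pos n).ne']

/-- Evaluate `K(X² P_n²)` twice: with `X² = 1 - (1 - X²)`, and by expanding one factor `X P_n`
through the recurrence. -/
lemma auxR_add (n : ℕ) :
    auxR t L K (n + 1) + auxR t L K n = auxX t L K n - 2 * t := by
  have hn := (S.sqNorm_pos n).ne'
  have hK : K (X ^ 2 * orthoPoly L n ^ 2) = K (orthoPoly L n ^ 2) - sqNorm L n := by
    rw [sqNorm, ← S.one_sub_sq, ← map_sub]; congr 1; ring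
  refine mul_left_cancel₀ hn ?_
  rcases n with _ | n
  · have h1 := S.sqNorm_mul_auxR 0
    have h2 := S.sqNorm_mul_auxX 0
    simp only [orthoPoly, auxR] at *
    rw [show (X : ℝ[X]) ^ 2 * 1 ^ 2 = X * X * 1 by ring] at hK
    linear_combination h1 - h2 + 2 * t * hK
  · have h1 := S.sqNorm_mul_auxR (n + 1)
    have h2 := S.sqNorm_mul_auxX (n + 1)
    have h3 := S.sqNorm_mul_auxR n
    have h4 := S.recCoeff_succ_mul n
    have e : K (X ^ 2 * orthoPoly L (n + 1) ^ 2) = K (X * orthoPoly L (n + 2) * orthoPoly L (n + 1))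
        + recCoeff L (n + 1) * K (X * orthoPoly L (n + 1) * orthoPoly L n) := by
      rw [← map_C_mul, ← map_add]
      congr 1
      linear_combination X * orthoPoly L (n + 1) * X_mul_orthoPoly_succ L n
    linear_combination h1 - h2 + 2 * t * hK - 2 * t * e + recCoeff L (n + 1) * h3
      - auxR t L K (n + 1) * h4

/-- The value of `K (P_{n+2} P_n)`. -/
lemma map_orthoPoly_add_two_mul (n : ℕ) :
    2 * t * K (orthoPoly L (n + 2) * orthoPoly L n) =
      sqNorm L n * (auxR t L K (n + 1) - recCoeff L (n + 1) * auxX t L K n) := by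
  have h1 := S.sqNorm_mul_auxR n
  have h2 := S.sqNorm_mul_auxX n
  have e : K (X * orthoPoly L (n + 1) * orthoPoly L n) = K (orthoPoly L (n + 2) * orthoPoly L n)
      + recCoeff L (n + 1) * K (orthoPoly L n ^ 2) := by
    rw [← map_C_mul, ← map_add]
    congr 1
    linear_combination orthoPoly L n * X_mul_orthoPoly_succ L n
  linear_combination -2 * t * e - h1 + recCoeff L (n + 1) * h2

/-- In `K(X P_{n+2} P_{n+1})` let the recurrence absorb `X` into `P_{n+1}`; the cross term
`K(P_{n+2} P_n)` is known from the same device one index lower. -/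
lemma auxR_sub (n : ℕ) : auxR t L K (n + 2) - auxR t L K (n + 1) =
    recCoeff L (n + 2) * auxX t L K (n + 2) - recCoeff L (n + 1) * auxX t L K n := by
  have h1 := S.sqNorm_mul_auxR (n + 1)
  have h2 := S.sqNorm_mul_auxX (n + 2)
  have h3 := S.recCoeff_succ_mul n
  have h4 := S.recCoeff_succ_mul (n + 1)
  have h5 := S.map_orthoPoly_add_two_mul n
  have e : K (X * orthoPoly L (n + 2) * orthoPoly L (n + 1)) = K (orthoPoly L (n + 2) ^ 2)
      + recCoeff L (n + 1) * K (orthoPoly L (n + 2) * orthoPoly L n) := by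
    rw [← map_C_mul, ← map_add]
    congr 1
    linear_combination orthoPoly L (n + 2) * X_mul_orthoPoly_succ L n
  refine mul_left_cancel₀ (S.sqNorm_pos (n + 1)).ne' ?_
  linear_combination h1 - h2 + 2 * t * e + recCoeff L (n + 1) * h5
    + (auxR t L K (n + 1) - recCoeff L (n + 1) * auxX t L K n) * h3
    - auxX t L K (n + 2) * h4

lemma auxR_one_sub : auxR t L K 1 - auxR t L K 0 = recCoeff L 1 * auxX t L K 1 := by
  have h1 := S.sqNorm_mul_auxR 0
  have h2 := S.sqNorm_mul_auxX 1
  have h4 := S.recCoeff_succ_mul 0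
  simp only [orthoPoly, auxR, zero_add] at *
  rw [show (X : ℝ[X]) * X * 1 = X ^ 2 by ring] at *
  refine mul_left_cancel₀ (S.sqNorm_pos 0).ne' ?_
  linear_combination h1 - h2 - auxX t L K 1 * h4

/-- Integration by parts with `q = P_n P_{n-1}`: the only `K`-term is `ρ_n`, and all `L`-terms
follow from leading and subleading coefficients. -/
lemma auxR_eq (n : ℕ) : auxR t L K n =
    n + 2 * subCoeff L n - (2 * n + 1 + 2 * α) * recCoeff L n := by
  rcases n with _ | n
  · simp [auxR, subCoeff, recCoeff]
  have hR := S.sqNorm_mul_auxR n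
  have hβ := S.recCoeff_succ_mul n
  have hp := S.parts (orthoPoly L (n + 1) * orthoPoly L n)
  set P := orthoPoly L (n + 1) with hP
  set Q := orthoPoly L n with hQ
  have e1 : L (Q * derivative P) = (n + 1) * sqNorm L n := by
    rw [hQ, S.map_orthoPoly_mul, coeff_derivative, hP, coeff_orthoPoly_self]
    · ring
    · intro k hk
      rw [coeff_derivative, coeff_orthoPoly_of_lt L (by omega), zero_mul]
  -- `X² P'` has degree `n + 2`; subtracting `(n + 1) P_{n+2}`, which is orthogonal to `Q`, brings
  -- the degree down to `n`.
  have e2 : L (Q * (X ^ 2 * derivative P - C ((n : ℝ) + 1) * orthoPoly L (n + 2))) =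
      ((n - 1) * subCoeff L (n + 1) - (n + 1) * subCoeff L (n + 2)) * sqNorm L n := by
    rw [hQ, S.map_orthoPoly_mul]
    · congr 1
      rw [coeff_sub, coeff_C_mul, coeff_orthoPoly_add_two]
      congr 1
      rcases n with _ | _ | n
      · simp [subCoeff, recCoeff]
      · simp [coeff_X_pow_mul']
      · rw [show n + 1 + 1 = n + 2 from rfl, coeff_X_pow_mul, coeff_derivative, hP,
          coeff_orthoPoly_add_two L (n + 1)]
        push_cast
        ring
    · intro k hk
      obtain ⟨k, rfl⟩ : ∃ j, k = j + 1 := ⟨k - 1, by omega⟩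
      rw [coeff_sub, coeff_C_mul]
      rcases k with _ | k
      · obtain rfl : n = 0 := by omega
        rw [coeff_orthoPoly_succ]
        simp [coeff_X_pow_mul']
      · rw [show k + 1 + 1 = k + 2 from rfl, coeff_X_pow_mul, coeff_derivative, hP]
        rcases Nat.lt_trichotomy k n with h | h | h
        · obtain rfl : n = k + 1 := by omega
          rw [coeff_orthoPoly_succ, coeff_orthoPoly_succ]; ring
        · subst h
          rw [coeff_orthoPoly_self, coeff_orthoPoly_self]; ring
        · rw [coeff_orthoPoly_of_lt L (by omega), coeff_orthoPoly_of_lt L (by omega)]; ring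
  have e3 : L (P * ((1 - X ^ 2) * derivative Q)) = -n * sqNorm L (n + 1) := by
    rw [hP, S.map_orthoPoly_mul]
    · congr 1
      rw [sub_mul, one_mul, coeff_sub, coeff_derivative, coeff_orthoPoly_of_lt L (by omega)]
      rcases n with _ | n
      · simp [hQ, orthoPoly]
      · rw [show n + 1 + 1 = n + 2 from rfl, coeff_X_pow_mul, coeff_derivative,
          coeff_orthoPoly_self]
        push_cast; ring
    · intro k hk
      obtain ⟨k, rfl⟩ : ∃ j, k = j + 2 := ⟨k - 2, by omega⟩
      rw [sub_mul, one_mul, coeff_sub, coeff_derivative, coeff_X_pow_mul, coeff_derivative,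
        coeff_orthoPoly_of_lt L (by omega), coeff_orthoPoly_of_lt L (by omega)]
      ring
  have e4 : L (X * (P * Q)) = sqNorm L (n + 1) := by
    rw [show X * (P * Q) = P * (X * Q) by ring, hP, S.map_orthoPoly_mul, coeff_X_mul,
      coeff_orthoPoly_self, one_mul]
    intro k hk
    obtain ⟨k, rfl⟩ : ∃ j, k = j + 1 := ⟨k - 1, by omega⟩
    rw [coeff_X_mul, coeff_orthoPoly_of_lt L (by omega)]
  have e5 : L (Q * orthoPoly L (n + 2)) = 0 := by
    rw [mul_comm]; exact S.orthogonal (n + 2) n (by omega)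
  have e6 : L ((1 - X ^ 2) * derivative (P * Q)) = L (Q * derivative P)
      - L (Q * (X ^ 2 * derivative P - C ((n : ℝ) + 1) * orthoPoly L (n + 2)))
      - (n + 1) * L (Q * orthoPoly L (n + 2)) + L (P * ((1 - X ^ 2) * derivative Q)) := by
    rw [← map_C_mul, ← map_sub, ← map_sub, ← map_add, derivative_mul]
    congr 1
    ring
  rw [e6, e1, e2, e3, e4, e5] at hp
  rw [mul_assoc X] at hR
  have h2 := subCoeff_succ L (n + 1)
  refine mul_left_cancel₀ (S.sqNorm_pos n).ne' ?_
  push_cast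
  rw [h2] at hp
  linear_combination hR - hp + (n + 2 + 2 * α) * hβ

end IsSemiclassical

/-! ### Algebraic relations with `σ_n` and the difference equation. -/

/-- The logarithmic derivative `σ_n = -∑_{j < n} x_j`, in terms of the functionals. -/
def auxSigma (t : ℝ) (L K : ℝ[X] →ₗ[ℝ] ℝ) (n : ℕ) : ℝ :=
  -∑ j ∈ Finset.range n, auxX t L K j

lemma auxSigma_succ (t : ℝ) (L K : ℝ[X] →ₗ[ℝ] ℝ) (n : ℕ) :
    auxSigma t L K (n + 1) = auxSigma t L K n - auxX t L K n := by
  simp only [auxSigma, Finset.sum_range_succ]; ring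

namespace IsSemiclassical

variable {α t : ℝ} {L K : ℝ[X] →ₗ[ℝ] ℝ} (S : IsSemiclassical α t L K)

include S

lemma recCoeff_step (n : ℕ) :
    (2 * n + 3 + 2 * α) * recCoeff L (n + 1) + auxR t L K (n + 1) - 1 =
      (2 * n - 1 + 2 * α) * recCoeff L n + auxR t L K n := by
  have h1 := S.auxR_eq n
  have h2 := S.auxR_eq (n + 1)
  rw [subCoeff_succ] at h2
  push_cast at h2
  linear_combination h2 - h1

lemma auxR_sub' (n : ℕ) : auxR t L K (n + 1) - auxR t L K n =
    recCoeff L (n + 1) * auxX t L K (n + 1) - recCoeff L n * auxX t L K (n - 1) := by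
  rcases n with _ | n
  · rw [S.auxR_one_sub]; simp [recCoeff]
  · exact S.auxR_sub n

/-- The algebraic relations obtained by summing the compatibility conditions. -/
lemma compatibility (n : ℕ) :
    (n * (n + 2 * α) - 2 * n * t - 2 * (n + α) * auxR t L K n - auxSigma t L K n =
      recCoeff L n * (2 * n + 1 + 2 * α) * (2 * n - 1 + 2 * α)) ∧
    (2 * n * t + 2 * (n + α) * auxR t L K n - auxR t L K n * (auxR t L K n + 2 * t) =
      recCoeff L n * ((2 * n + 1 + 2 * α) * auxX t L K (n - 1)
        + (2 * n - 1 + 2 * α) * auxX t L K n)) ∧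
    (auxR t L K n * (auxR t L K n + 2 * t) =
      recCoeff L n * auxX t L K n * auxX t L K (n - 1)) := by
  induction n with
  -- The truncated index `n - 1` is harmless at `0`, because `β_0 = 0` multiplies it.
  | zero => simp [auxR, recCoeff, auxSigma]
  | succ n ih =>
    obtain ⟨E1, E2, E3⟩ := ih
    have E0 := S.auxR_add n
    have E4 := S.recCoeff_step n
    have E5 := S.auxR_sub' n
    rw [auxSigma_succ, Nat.add_sub_cancel]
    push_cast
    refine ⟨?_, ?_, ?_⟩
    -- In each relation the difference of the two sides takes the same value at `n + 1` as at `n`.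
    · linear_combination E1 - (2 * n + 1 + 2 * α) * E4 - E0
    · linear_combination E2 - auxX t L K n * E4 + (2 * n + 1 + 2 * α) * E5
        + (1 - (auxR t L K (n + 1) - auxR t L K n)) * E0
    · linear_combination E3 + auxX t L K n * E5 + (auxR t L K (n + 1) - auxR t L K n) * E0

lemma satisfiesDifferenceEq (n : ℕ) :
    SatisfiesDifferenceEq ((n + 1 : ℕ) : ℝ) α t (auxSigma t L K n) (auxSigma t L K (n + 1))
      (auxSigma t L K (n + 2)) := by
  obtain ⟨E1, E2, E3⟩ := S.compatibility (n + 1)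
  rw [Nat.add_sub_cancel] at E2 E3
  rw [auxSigma_succ t L K (n + 1)]
  have hs := auxSigma_succ t L K n
  generalize ((n + 1 : ℕ) : ℝ) = m at *
  generalize auxR t L K (n + 1) = r at *
  generalize recCoeff L (n + 1) = b at *
  generalize auxX t L K (n + 1) = x at *
  generalize auxSigma t L K (n + 1) = s at *
  obtain ⟨y, hy⟩ : ∃ y, y = auxX t L K n := ⟨_, rfl⟩
  rw [← hy] at E2 E3 hs
  rw [show auxSigma t L K n = s + y by linear_combination -hs]
  -- The sum of the three relations: `ρ` cancels and the right-hand sides factor as `β g`.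
  have hg : b * diffG m α (s + y) s (s - x) = m * (m + 2 * α) - s := by
    unfold diffG
    linear_combination -E1 - E2 - E3
  -- The first relation times `g`, with `β g` replaced. It makes `ρ` rational in the `σ`'s; the
  -- third relation times `g²` then gives the equation.
  have hX : (m * (m + 2 * α - 2 * t) - s) * diffF m α (s + y) s (s - x)
      - 2 * m * t * (2 * m - 1 + 2 * α) * (2 * m + 1 + 2 * α) =
      2 * (m + α) * diffG m α (s + y) s (s - x) * r := by
    have hf : diffF m α (s + y) s (s - x) =
        diffG m α (s + y) s (s - x) - (2 * m - 1 + 2 * α) * (2 * m + 1 + 2 * α) := by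
      unfold diffF diffG; ring
    rw [hf]
    linear_combination diffG m α (s + y) s (s - x) * E1
      + (2 * m - 1 + 2 * α) * (2 * m + 1 + 2 * α) * hg
  unfold SatisfiesDifferenceEq
  rw [hX]
  generalize diffG m α (s + y) s (s - x) = g at *
  linear_combination 4 * (m + α) ^ 2 * g ^ 2 * E3 + 4 * (m + α) ^ 2 * x * y * g * hg

end IsSemiclassical

/-! ### Elimination of `ρ_n` in the differential equation. -/

/-- The differential equation follows from the quadratic equation for `ρ_n` and its derivative
`ρ_n'` (here `r` and `r₁`) together with the relation between `ρ_n`, `ρ_n'` and `σ_n`. -/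
lemma satisfiesODE_of_relations {n α t s s₁ s₂ r r₁ : ℝ} (ht : t ≠ 0)
    (h₁ : 2 * t * s₁ = -2 * n * t - 2 * (n + α + t) * r - r ^ 2)
    (h₂ : 2 * s₁ + 2 * t * s₂ = -2 * n - 2 * r - 2 * (n + α + t) * r₁ - 2 * r * r₁)
    (h₃ : (2 * n * t + 2 * (n + α) * r - r * (r + 2 * t)) ^ 2 - (2 * r - 2 * t * r₁) ^ 2 =
      4 * r * (r + 2 * t) * (n * (n + 2 * α) - 2 * n * t - 2 * (n + α) * r - s)) :
    SatisfiesODE n α t s s₁ s₂ := by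
  -- In `u = t s₁` and `v = t² s₂` the equation is polynomial without division by `t`.
  obtain ⟨u, hu⟩ : ∃ u, u = t * s₁ := ⟨_, rfl⟩
  obtain ⟨v, hv⟩ : ∃ v, v = t ^ 2 * s₂ := ⟨_, rfl⟩
  have hu' : u = (-2 * n * t - 2 * (n + α + t) * r - r ^ 2) / 2 := by
    rw [hu]; linear_combination h₁ / 2
  have hv' : v = t * (-n - r - (n + α + t) * r₁ - r * r₁) - u := by
    rw [hv, hu]; linear_combination t * h₂ / 2
  obtain rfl : s₁ = u / t := by rw [hu]; field_simp
  obtain rfl : s₂ = v / t ^ 2 := by rw [hv]; field_simp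
  -- The unsquared equation, in which `r + n + α + t` is the square root of the factor on the right
  -- (`hQ`).
  have key : (v ^ 2 + 2 * ((n + α) ^ 2 + t * α - u) * v + 2 * u ^ 3
      - ((t + α) ^ 2 - 3 * n * (n + 2 * α) - 1 + 4 * s) * u ^ 2
      - 2 * (3 * n ^ 4 + 12 * n ^ 3 * α + n ^ 2 * (t ^ 2 + 4 * t * α + 15 * α ^ 2 + 2)
          + 2 * n * α * (t ^ 2 + 4 * t * α + 3 * α ^ 2 + 2) + α * (t + 2 * α)) * u
      + 2 * (3 * (n + α) ^ 2 + t * (t + 4 * α)) * s * u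
      - (2 * n ^ 4 + 8 * n ^ 3 * α + 2 * n ^ 2 * (t ^ 2 + 3 * t * α + 6 * α ^ 2)
          + 4 * n * α * (t + α) * (t + 2 * α) + 2 * α * (t + α) ^ 3) * s
      + 2 * n ^ 6 + 12 * n ^ 5 * α
      + 2 * (t ^ 2 + 3 * t * α + 14 * α ^ 2 + 1) * n ^ 4
      + 8 * n ^ 3 * α * (t ^ 2 + 3 * t * α + 4 * α ^ 2 + 1)
      + n ^ 2 * (2 * t ^ 3 * α + (14 * α ^ 2 + 1) * t ^ 2
          + 2 * t * α * (15 * α ^ 2 + 2) + 6 * α ^ 2 * (3 * α ^ 2 + 2))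
      + n * (4 * t ^ 3 * α ^ 2 + 2 * t ^ 2 * α * (6 * α ^ 2 + 1)
          + 4 * t * α ^ 2 * (3 * α ^ 2 + 2) + 4 * α ^ 3 * (α ^ 2 + 2))
      + 2 * α ^ 2 * (t + α) ^ 2) =
      2 * (n + α) * (r + n + α + t) * (v - (2 * n ^ 2 + 4 * n * α + 1 - 2 * s) * u
        - ((n + α) ^ 2 + t * (t + 2 * α)) * s + n ^ 4 + 4 * n ^ 3 * α + α * (t + α)
        + n ^ 2 * (t ^ 2 + 2 * t * α + 5 * α ^ 2 + 1) + 2 * n * α * ((t + α) ^ 2 + 1)) := by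
    rw [hv', hu']
    linear_combination (-(r + n + α + t) ^ 2 / 4) * h₃
  have hQ : (n + α) ^ 2 + t * (t + 2 * α) - 2 * u = (r + n + α + t) ^ 2 := by
    rw [hu']; ring
  have e1 : t * (u / t) = u := by field_simp
  have e2 : t ^ 2 * (v / t ^ 2) = v := by field_simp
  have sq : ∀ A B Q Z c : ℝ, A = 2 * c * Z * B → Q = Z ^ 2 → A ^ 2 = 4 * c ^ 2 * Q * B ^ 2 := by
    rintro A B Q Z c rfl rfl; ring
  unfold SatisfiesODE
  generalize u / t = s₁ at *
  generalize v / t ^ 2 = s₂ at *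
  clear hu hv hu' hv' h₁ h₂ h₃
  subst e1 e2
  refine sq _ _ _ (r + n + α + t) (n + α) ?_ ?_
  · linear_combination key
  · linear_combination hQ

/-! ### Dependence on `t`: Toda-type equations. -/

/-- The coefficients of the family `p` of polynomials have at `t` the derivatives `p'.coeff i`. -/
def CoeffHasDerivAt (p : ℝ → ℝ[X]) (p' : ℝ[X]) (t : ℝ) : Prop :=
  ∀ i, HasDerivAt (fun s => (p s).coeff i) (p'.coeff i) t

namespace CoeffHasDerivAt

variable {p q : ℝ → ℝ[X]} {p' q' : ℝ[X]} {t : ℝ}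

lemma const (r : ℝ[X]) (t : ℝ) : CoeffHasDerivAt (fun _ => r) 0 t := fun i => by
  simpa using hasDerivAt_const t (r.coeff i)

lemma C {f : ℝ → ℝ} {f' : ℝ} (hf : HasDerivAt f f' t) :
    CoeffHasDerivAt (fun s => C (f s)) (C f') t := fun i => by
  simp only [coeff_C]
  split_ifs
  · exact hf
  · exact hasDerivAt_const t 0

lemma sub (hp : CoeffHasDerivAt p p' t) (hq : CoeffHasDerivAt q q' t) :
    CoeffHasDerivAt (fun s => p s - q s) (p' - q') t := fun i => by
  simpa only [coeff_sub] using (hp i).fun_sub (hq i)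

lemma mul (hp : CoeffHasDerivAt p p' t) (hq : CoeffHasDerivAt q q' t) :
    CoeffHasDerivAt (fun s => p s * q s) (p' * q t + p t * q') t := fun i => by
  simp only [coeff_mul, coeff_add, ← Finset.sum_add_distrib]
  exact HasDerivAt.fun_sum fun x _ => (hp x.1).mul (hq x.2)

end CoeffHasDerivAt

section Family

variable {α : ℝ} {L K : ℝ → ℝ[X] →ₗ[ℝ] ℝ}

/-- The product rule for a moving functional at a moving polynomial; the degree bound uniform in `s`
reduces it to a fixed finite sum. -/
lemma hasDerivAt_map {t : ℝ} (hD : ∀ p, HasDerivAt (fun s => L s p) (-K t p) t)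
    {p : ℝ → ℝ[X]} {p' : ℝ[X]} (hp : CoeffHasDerivAt p p' t) {N : ℕ}
    (hN : ∀ s, (p s).natDegree < N) :
    HasDerivAt (fun s => L s (p s)) (L t p' - K t (p t)) t := by
  have expand : ∀ (M : ℝ[X] →ₗ[ℝ] ℝ) (r : ℝ[X]), r.natDegree < N →
      M r = ∑ i ∈ Finset.range N, r.coeff i * M (X ^ i) := by
    intro M r hr
    conv_lhs => rw [r.as_sum_range' N hr]
    rw [map_sum]
    refine Finset.sum_congr rfl fun i _ => ?_
    rw [← C_mul_X_pow_eq_monomial, map_C_mul]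
  have hp' : p'.natDegree < N := by
    have hN0 : 0 < N := (Nat.zero_le _).trans_lt (hN t)
    by_cases h0 : p' = 0
    · simpa [h0] using hN0
    rw [natDegree_lt_iff_degree_lt h0, degree_lt_iff_coeff_zero]
    intro k hk
    have h := hp k
    simp only [fun s => coeff_eq_zero_of_natDegree_lt ((hN s).trans_le hk)] at h
    exact h.unique (hasDerivAt_const t 0)
  have e : (fun s => L s (p s)) =
      fun s => ∑ i ∈ Finset.range N, (p s).coeff i * L s (X ^ i) := by
    funext s; exact expand _ _ (hN s)
  rw [e, expand _ _ hp', expand _ _ (hN t), ← Finset.sum_sub_distrib]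
  refine HasDerivAt.fun_sum fun i _ => ?_
  exact ((hp i).fun_mul (hD (X ^ i))).congr_deriv (by ring)

/-- Only existence matters: the recurrence divides by nonzero norms, and orthogonality later removes
most of `P'`. -/
lemma orthoPoly_coeffHasDerivAt {t : ℝ} (hD : ∀ p, HasDerivAt (fun s => L s p) (-K t p) t)
    (hS : IsSemiclassical α t (L t) (K t)) (n : ℕ) :
    ∃ P', CoeffHasDerivAt (fun s => orthoPoly (L s) n) P' t := by
  have key : ∀ n, (∃ P', CoeffHasDerivAt (fun s => orthoPoly (L s) n) P' t) →
      DifferentiableAt ℝ (fun s => L s (orthoPoly (L s) n ^ 2)) t := by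
    rintro n ⟨P', hP⟩
    refine (hasDerivAt_map hD (p := fun s => orthoPoly (L s) n ^ 2) (N := 2 * n + 1)
      (by simpa only [sq] using hP.mul hP) fun s => ?_).differentiableAt
    have := natDegree_orthoPoly_le (L s) n
    exact natDegree_pow_le.trans_lt (by omega)
  induction n using Nat.twoStepInduction with
  | zero => exact ⟨0, CoeffHasDerivAt.const _ _⟩
  | one => exact ⟨0, CoeffHasDerivAt.const _ _⟩
  | more n h0 h1 =>
    have hb := ((key _ h1).div (key _ h0) (hS.sqNorm_pos n).ne').hasDerivAt
    obtain ⟨P0, h0⟩ := h0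
    obtain ⟨P1, h1⟩ := h1
    exact ⟨_, ((CoeffHasDerivAt.const X t).mul h1).sub ((CoeffHasDerivAt.C hb).mul h0)⟩

/-- The coefficients of `P_n` from `X ^ (n - 1)` upwards do not depend on `s`. -/
lemma CoeffHasDerivAt.orthoPoly_coeff_eq_zero {t : ℝ} {n : ℕ} {P' : ℝ[X]}
    (hP : CoeffHasDerivAt (fun s => orthoPoly (L s) n) P' t) {j : ℕ} (hj : n ≤ j + 1) :
    P'.coeff j = 0 := by
  have h := hP j
  rcases hj.eq_or_lt with rfl | hj
  · simp only [coeff_orthoPoly_succ] at h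
    exact h.unique (hasDerivAt_const t 0)
  rcases (Nat.le_of_lt_succ hj).eq_or_lt with rfl | hj
  · simp only [coeff_orthoPoly_self] at h
    exact h.unique (hasDerivAt_const t 1)
  · simp only [fun s => coeff_orthoPoly_of_lt (L s) hj] at h
    exact h.unique (hasDerivAt_const t 0)

/-- The derivative of `L (P_n P_k)`, `n - 2 ≤ k ≤ n`, in terms of the derivative `P'` of `P_n`. -/
lemma hasDerivAt_map_orthoPoly_mul {t : ℝ}
    (hD : ∀ p, HasDerivAt (fun s => L s p) (-K t p) t)
    (hS : IsSemiclassical α t (L t) (K t)) {n k : ℕ} (hk : k ≤ n) (hn : n ≤ k + 2) {P' : ℝ[X]}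
    (hP : CoeffHasDerivAt (fun s => orthoPoly (L s) n) P' t) :
    HasDerivAt (fun s => L s (orthoPoly (L s) n * orthoPoly (L s) k))
      (P'.coeff k * sqNorm (L t) k - K t (orthoPoly (L t) n * orthoPoly (L t) k)) t := by
  obtain ⟨Q', hQ⟩ := orthoPoly_coeffHasDerivAt hD hS k
  have h := hasDerivAt_map hD (hP.mul hQ) (N := n + k + 1) fun s => by
    have h1 := natDegree_orthoPoly_le (L s) n
    have h2 := natDegree_orthoPoly_le (L s) k
    exact natDegree_mul_le.trans_lt (by omega)
  have h2 : L t (orthoPoly (L t) n * Q') = 0 := by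
    rw [hS.map_orthoPoly_mul n Q' fun j hj => hQ.orthoPoly_coeff_eq_zero (by omega),
      hQ.orthoPoly_coeff_eq_zero (by omega), zero_mul]
  have h1 : L t (P' * orthoPoly (L t) k) = P'.coeff k * sqNorm (L t) k := by
    rw [mul_comm P', hS.map_orthoPoly_mul k P' fun j hj =>
      hP.orthoPoly_coeff_eq_zero (by omega)]
  rwa [map_add, h1, h2, add_zero] at h

lemma hasDerivAt_sqNorm {t : ℝ} (hD : ∀ p, HasDerivAt (fun s => L s p) (-K t p) t)
    (hS : IsSemiclassical α t (L t) (K t)) (n : ℕ) :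
    HasDerivAt (fun s => sqNorm (L s) n) (-K t (orthoPoly (L t) n ^ 2)) t := by
  obtain ⟨P', hP⟩ := orthoPoly_coeffHasDerivAt hD hS n
  have h := hasDerivAt_map_orthoPoly_mul hD hS le_rfl (by omega) hP
  rw [hP.orthoPoly_coeff_eq_zero (by omega), zero_mul, zero_sub] at h
  simpa only [sqNorm, sq] using h

lemma hasDerivAt_recCoeff {t : ℝ} (ht : 0 < t)
    (hD : ∀ p, HasDerivAt (fun s => L s p) (-K t p) t)
    (hS : IsSemiclassical α t (L t) (K t)) (n : ℕ) :
    HasDerivAt (fun s => recCoeff (L s) (n + 1)) (recCoeff (L t) (n + 1) *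
      (auxX t (L t) (K t) n - auxX t (L t) (K t) (n + 1)) / (2 * t)) t := by
  have h0 := hS.sqNorm_pos n
  have h1 := hS.sqNorm_pos (n + 1)
  refine ((hasDerivAt_sqNorm hD hS (n + 1)).fun_div (hasDerivAt_sqNorm hD hS n)
    h0.ne').congr_deriv ?_
  simp only [auxX, recCoeff]
  field_simp
  ring

variable (hS : ∀ s, 0 < s → IsSemiclassical α s (L s) (K s))
  (hD : ∀ s, 0 < s → ∀ p, HasDerivAt (fun s => L s p) (-K s p) s) {t : ℝ} (ht : 0 < t)

include hS hD ht

/-- Differentiate the orthogonality relation `L(P_{n+2} P_n) = 0`. -/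
lemma hasDerivAt_subCoeff (n : ℕ) :
    HasDerivAt (fun s => subCoeff (L s) (n + 2)) ((auxR t (L t) (K t) (n + 1)
      - recCoeff (L t) (n + 1) * auxX t (L t) (K t) n) / (2 * t)) t := by
  obtain ⟨P', hP⟩ := orthoPoly_coeffHasDerivAt (hD t ht) (hS t ht) (n + 2)
  have h := hP n
  simp only [coeff_orthoPoly_add_two] at h
  refine h.congr_deriv ?_
  have h1 := hasDerivAt_map_orthoPoly_mul (hD t ht) (hS t ht) (by omega) le_rfl hP
  have h2 : HasDerivAt (fun s => L s (orthoPoly (L s) (n + 2) * orthoPoly (L s) n)) 0 t := by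
    refine (hasDerivAt_const t (0 : ℝ)).congr_of_eventuallyEq ?_
    filter_upwards [lt_mem_nhds ht] with s hs
    exact (hS s hs).orthogonal (n + 2) n (by omega)
  have h3 := h1.unique h2
  have h4 := (hS t ht).map_orthoPoly_add_two_mul n
  have h0 := (hS t ht).sqNorm_pos n
  rw [eq_div_iff (by positivity)]
  refine mul_left_cancel₀ h0.ne' ?_
  linear_combination 2 * t * h3 + h4

/-- The differential equation for `ρ_n`. -/
lemma hasDerivAt_auxR (n : ℕ) :
    HasDerivAt (fun s => auxR s (L s) (K s) (n + 1)) ((2 * auxR t (L t) (K t) (n + 1)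
      - (2 * n + 3 + 2 * α) * (recCoeff (L t) (n + 1) * auxX t (L t) (K t) n)
      + (2 * n + 1 + 2 * α) * (recCoeff (L t) (n + 1) * auxX t (L t) (K t) (n + 1)))
      / (2 * t)) t := by
  have h1 := hasDerivAt_recCoeff ht (hD t ht) (hS t ht) n
  have h2 := hasDerivAt_subCoeff hS hD ht n
  -- This is `auxR_eq` with the subleading coefficient of `P_{n+1}` rewritten through that of
  -- `P_{n+2}`, which turns `2n + 3 + 2α` into `2n + 1 + 2α`.
  have h3 := ((h2.const_mul 2).const_add ((n : ℝ) + 1)).sub (h1.const_mul (2 * n + 1 + 2 * α))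
  refine (h3.congr_of_eventuallyEq ?_).congr_deriv ?_
  · filter_upwards [lt_mem_nhds ht] with s hs
    have h4 := (hS s hs).auxR_eq (n + 1)
    have h5 := subCoeff_succ (L s) (n + 1)
    push_cast at h4
    simp only [Pi.sub_apply]
    rw [h4]
    linear_combination -2 * h5
  · field_simp
    ring

/-- Differentiate the first relation of `compatibility`, then remove the products `β x` with the
second. -/
lemma hasDerivAt_auxSigma (n : ℕ) :
    HasDerivAt (fun s => auxSigma s (L s) (K s) (n + 1))
      ((-2 * (n + 1) * t - 2 * (n + 1 + α + t) * auxR t (L t) (K t) (n + 1)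
        - auxR t (L t) (K t) (n + 1) ^ 2) / (2 * t)) t := by
  have h1 := hasDerivAt_recCoeff ht (hD t ht) (hS t ht) n
  have h2 := hasDerivAt_auxR hS hD ht n
  have h3 := (((hasDerivAt_id t).const_mul (2 * ((n : ℝ) + 1))).const_sub
    (((n : ℝ) + 1) * (n + 1 + 2 * α))).sub (h2.const_mul (2 * ((n : ℝ) + 1 + α)))
  have h4 := h3.sub (h1.const_mul ((2 * (n : ℝ) + 3 + 2 * α) * (2 * n + 1 + 2 * α)))
  refine (h4.congr_of_eventuallyEq ?_).congr_deriv ?_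
  · filter_upwards [lt_mem_nhds ht] with s hs
    obtain ⟨E1, -, -⟩ := (hS s hs).compatibility (n + 1)
    push_cast at E1
    simp only [Pi.sub_apply, id]
    linear_combination -E1
  · obtain ⟨-, E2, -⟩ := (hS t ht).compatibility (n + 1)
    rw [Nat.add_sub_cancel] at E2
    push_cast at E2
    rw [eq_div_iff (by positivity)]
    field_simp
    linear_combination -E2

lemma satisfiesODE_auxSigma (n : ℕ) :
    DifferentiableAt ℝ (fun s => auxSigma s (L s) (K s) n) t ∧
    DifferentiableAt ℝ (deriv fun s => auxSigma s (L s) (K s) n) t ∧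
    SatisfiesODE n α t (auxSigma t (L t) (K t) n) (deriv (fun s => auxSigma s (L s) (K s) n) t)
      (deriv (deriv fun s => auxSigma s (L s) (K s) n) t) := by
  rcases n with _ | n
  · simp only [auxSigma, Finset.range_zero, Finset.sum_empty, neg_zero, deriv_const',
      SatisfiesODE]
    refine ⟨differentiableAt_const _, differentiableAt_const _, ?_⟩
    push_cast
    ring
  set m : ℝ := (n : ℝ) + 1 with hm
  set ρ : ℝ → ℝ := fun s => auxR s (L s) (K s) (n + 1) with hρ
  set F : ℝ → ℝ := fun s => -2 * m * s - 2 * (m + α + s) * ρ s - ρ s ^ 2 with hF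
  have h1 := hasDerivAt_auxSigma hS hD ht n
  have hdρ := hasDerivAt_auxR hS hD ht n
  obtain ⟨r₁, hr₁⟩ : ∃ r₁, r₁ = deriv ρ t := ⟨_, rfl⟩
  have hdr : HasDerivAt ρ r₁ t := hr₁ ▸ hdρ.differentiableAt.hasDerivAt
  have hdF : HasDerivAt F (-2 * m - 2 * ρ t - 2 * (m + α + t) * r₁ - 2 * ρ t * r₁) t := by
    have := ((((hasDerivAt_id t).const_mul (-2 * m)).sub
      ((((hasDerivAt_id t).const_add (m + α)).const_mul 2).mul hdr))).sub (hdr.pow 2)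
    refine this.congr_deriv ?_
    simp
    ring
  have hev : deriv (fun s => auxSigma s (L s) (K s) (n + 1)) =ᶠ[nhds t] fun s => F s / (2 * s) := by
    filter_upwards [lt_mem_nhds ht] with s hs
    exact (hasDerivAt_auxSigma hS hD hs n).deriv
  have h2 : HasDerivAt (deriv fun s => auxSigma s (L s) (K s) (n + 1)) _ t :=
    (hdF.div ((hasDerivAt_id t).const_mul 2) (by simpa using ht.ne')).congr_of_eventuallyEq hev
  refine ⟨h1.differentiableAt, h2.differentiableAt, ?_⟩
  obtain ⟨E1, E2, E3⟩ := (hS t ht).compatibility (n + 1)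
  rw [Nat.add_sub_cancel] at E2 E3
  have hr : 2 * t * r₁ = 2 * ρ t
      - (2 * n + 3 + 2 * α) * (recCoeff (L t) (n + 1) * auxX t (L t) (K t) n)
      + (2 * n + 1 + 2 * α) * (recCoeff (L t) (n + 1) * auxX t (L t) (K t) (n + 1)) := by
    rw [hr₁, hdρ.deriv]
    field_simp
    rfl
  have e1 : deriv (fun s => auxSigma s (L s) (K s) (n + 1)) t = F t / (2 * t) := hev.self_of_nhds
  rw [h2.deriv, e1]
  push_cast at E1 E2 ⊢
  rw [← hm] at E1 E2 ⊢
  have hn : (n : ℝ) = m - 1 := by rw [hm]; ring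
  rw [hn] at hr
  refine satisfiesODE_of_relations (r := ρ t) (r₁ := r₁) ht.ne' ?_ ?_ ?_
  · rw [mul_div_cancel₀ _ (by positivity)]
  · simp only [id]
    field_simp
    ring
  -- With `A = (2m+1+2α) β x_{n}` and `B = (2m-1+2α) β x_{n+1}` this is `(A + B)² - (A - B)² = 4AB`,
  -- rewritten by the first and third relations.
  · have e2 : 2 * m * t + 2 * (m + α) * ρ t - ρ t * (ρ t + 2 * t) = _ := E2
    have e3 : ρ t * (ρ t + 2 * t) = _ := E3
    have e4 : 2 * ρ t - 2 * t * r₁ =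
      (2 * m + 1 + 2 * α) * (recCoeff (L t) (n + 1) * auxX t (L t) (K t) n)
      - (2 * m - 1 + 2 * α) * (recCoeff (L t) (n + 1) * auxX t (L t) (K t) (n + 1)) := by
      linear_combination -hr
    have e5 : m * (m + 2 * α) - 2 * m * t - 2 * (m + α) * ρ t
      - auxSigma t (L t) (K t) (n + 1) = _ := E1
    rw [e2, e4, e5, mul_assoc 4, e3]
    ring

end Family

/-! ### Moment functionals. -/

/-- The functional on polynomials with moments `m`. -/
def momentFunctional (m : ℕ → ℝ) : ℝ[X] →ₗ[ℝ] ℝ :=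
  Polynomial.lsum fun i => m i • LinearMap.id

lemma momentFunctional_apply (m : ℕ → ℝ) (p : ℝ[X]) :
    momentFunctional m p = ∑ i ∈ p.support, p.coeff i * m i := by
  simp [momentFunctional, Polynomial.lsum_apply, Polynomial.sum_def, mul_comm]

lemma momentFunctional_X_pow (m : ℕ → ℝ) (k : ℕ) : momentFunctional m (X ^ k) = m k := by
  rw [← monomial_one_right_eq_X_pow, momentFunctional, Polynomial.lsum_apply, sum_monomial_index]
    <;> simp

lemma momentFunctional_eq_integral {g : ℝ → ℝ} (hg : IntervalIntegrable g volume (-1) 1)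
    (p : ℝ[X]) : momentFunctional (fun k => ∫ x in (-1 : ℝ)..1, x ^ k * g x) p =
      ∫ x in (-1 : ℝ)..1, p.eval x * g x := by
  rw [momentFunctional_apply]
  simp only [eval_eq_sum, Polynomial.sum_def, Finset.sum_mul, mul_assoc]
  rw [intervalIntegral.integral_finsetSum]
  · simp only [intervalIntegral.integral_const_mul]
  · intro i _
    exact (hg.continuousOn_mul (by fun_prop)).const_mul _

/-! ### The weight: integrability, differentiation in `t`, integration by parts. -/

section Weight

variable {α t : ℝ}

lemma measurable_weight (α t : ℝ) : Measurable (weight α t) := by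
  unfold weight; fun_prop

lemma one_sub_sq_pos {x : ℝ} (hx : x ∈ Set.Ioo (-1 : ℝ) 1) : 0 < 1 - x ^ 2 := by
  nlinarith [hx.1, hx.2]

lemma one_sub_sq_nonneg {x : ℝ} (hx : x ∈ Set.Icc (-1 : ℝ) 1) : 0 ≤ 1 - x ^ 2 := by
  nlinarith [hx.1, hx.2]

lemma weight_pos {x : ℝ} (hx : x ∈ Set.Ioo (-1 : ℝ) 1) : 0 < weight α t x :=
  mul_pos (Real.rpow_pos_of_pos (one_sub_sq_pos hx) _) (Real.exp_pos _)

lemma weight_nonneg {x : ℝ} (hx : x ∈ Set.Icc (-1 : ℝ) 1) : 0 ≤ weight α t x :=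
  mul_nonneg (Real.rpow_nonneg (one_sub_sq_nonneg hx) _) (Real.exp_pos _).le

/-- Division by zero makes the exponential equal to `1` here, so the vanishing comes from `0 ^ α`.
-/
lemma weight_eq_zero (hα : 0 < α) {x : ℝ} (hx : 1 - x ^ 2 = 0) : weight α t x = 0 := by
  rw [weight, hx, Real.zero_rpow hα.ne', zero_mul]

lemma weight_le_one (hα : 0 < α) (ht : 0 < t) {x : ℝ} (hx : x ∈ Set.Icc (-1 : ℝ) 1) :
    weight α t x ≤ 1 := by
  have hb := one_sub_sq_nonneg hx
  have h1 : (1 - x ^ 2) ^ α ≤ 1 := Real.rpow_le_one hb (by nlinarith) hα.le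
  have h2 : Real.exp (-t / (1 - x ^ 2)) ≤ 1 :=
    Real.exp_le_one_iff.2 (div_nonpos_of_nonpos_of_nonneg (by linarith) hb)
  exact mul_le_one₀ h1 (Real.exp_pos _).le h2

/-- From `y e^{-y} ≤ 1` at `y = t/(1-x²)`: the exponential absorbs the pole at the endpoints. -/
lemma weight_div_le (hα : 0 < α) (ht : 0 < t) {x : ℝ} (hx : x ∈ Set.Icc (-1 : ℝ) 1) :
    weight α t x / (1 - x ^ 2) ≤ 1 / t := by
  rcases (one_sub_sq_nonneg hx).eq_or_lt with hb | hb
  · rw [← hb, div_zero]; positivity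
  have h1 : (1 - x ^ 2) ^ α ≤ 1 := Real.rpow_le_one hb.le (by nlinarith) hα.le
  have h2 : t / (1 - x ^ 2) * Real.exp (-t / (1 - x ^ 2)) ≤ 1 := by
    have h3 := Real.add_one_le_exp (t / (1 - x ^ 2))
    rw [neg_div, Real.exp_neg, ← div_eq_mul_inv, div_le_one (Real.exp_pos _)]
    linarith
  rw [div_le_div_iff₀ hb ht, weight]
  have h4 : t * Real.exp (-t / (1 - x ^ 2)) ≤ 1 - x ^ 2 := by
    rw [div_mul_eq_mul_div, div_le_one hb] at h2
    exact h2
  have h5 : 0 ≤ t * Real.exp (-t / (1 - x ^ 2)) := by positivity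
  nlinarith

lemma weight_div_nonneg {x : ℝ} (hx : x ∈ Set.Icc (-1 : ℝ) 1) :
    0 ≤ weight α t x / (1 - x ^ 2) :=
  div_nonneg (weight_nonneg hx) (one_sub_sq_nonneg hx)

lemma intervalIntegrable_of_bounded {g : ℝ → ℝ} (hg : Measurable g) {M : ℝ}
    (h : ∀ x ∈ Set.Icc (-1 : ℝ) 1, ‖g x‖ ≤ M) : IntervalIntegrable g volume (-1) 1 := by
  rw [intervalIntegrable_iff_integrableOn_Icc_of_le (by norm_num)]
  exact Measure.integrableOn_of_bounded (by simp) hg.aestronglyMeasurable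
    ((ae_restrict_iff' measurableSet_Icc).2 (Filter.Eventually.of_forall h))

lemma intervalIntegrable_weight (hα : 0 < α) (ht : 0 < t) :
    IntervalIntegrable (weight α t) volume (-1) 1 :=
  intervalIntegrable_of_bounded (measurable_weight α t) (M := 1) fun x hx => by
    rw [Real.norm_of_nonneg (weight_nonneg hx)]; exact weight_le_one hα ht hx

lemma intervalIntegrable_weight_div (hα : 0 < α) (ht : 0 < t) :
    IntervalIntegrable (fun x => weight α t x / (1 - x ^ 2)) volume (-1) 1 :=
  intervalIntegrable_of_bounded ((measurable_weight α t).div (by fun_prop)) (M := 1 / t)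
    fun x hx => by
      rw [Real.norm_of_nonneg (weight_div_nonneg hx)]; exact weight_div_le hα ht hx

/-- The moments of `w(x,t) / (1 - x²)`. -/
def divMoment (α : ℝ) (k : ℕ) (t : ℝ) : ℝ :=
  ∫ x in (-1 : ℝ)..1, x ^ k * (weight α t x / (1 - x ^ 2))

lemma hasDerivAt_weight (α t x : ℝ) :
    HasDerivAt (fun s => weight α s x) (-(weight α t x / (1 - x ^ 2))) t := by
  unfold weight
  have h := (((hasDerivAt_id t).fun_neg.div_const (1 - x ^ 2)).exp).const_mul ((1 - x ^ 2) ^ α)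
  refine h.congr_deriv ?_
  simp only [id]
  ring

lemma hasDerivAt_moment (hα : 0 < α) (k : ℕ) (ht : 0 < t) :
    HasDerivAt (moment α k) (-divMoment α k t) t := by
  have hs : ∀ s ∈ Metric.ball t (t / 2), t / 2 < s := fun s hs => by
    rw [Real.ball_eq_Ioo] at hs; linarith [hs.1]
  -- On the ball `s > t/2`, so the bound `1/s` is dominated by the constant `2/t`.
  have h := intervalIntegral.hasDerivAt_integral_of_dominated_loc_of_deriv_le
    (μ := volume) (a := -1) (b := 1) (F := fun s x => x ^ k * weight α s x)
    (F' := fun s x => x ^ k * -(weight α s x / (1 - x ^ 2))) (x₀ := t)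
    (s := Metric.ball t (t / 2)) (bound := fun _ => 2 / t) (Metric.ball_mem_nhds t (by positivity))
    ?_ ?_ ?_ ?_ ?_ ?_
  · unfold moment divMoment
    simpa only [mul_neg, intervalIntegral.integral_neg] using h.2
  · exact Filter.Eventually.of_forall fun s =>
      ((measurable_id.pow_const k).mul (measurable_weight α s)).aestronglyMeasurable
  · exact (intervalIntegrable_weight hα ht).continuousOn_mul (by fun_prop)
  · exact ((measurable_id.pow_const k).mul
      ((measurable_weight α t).div (by fun_prop)).neg).aestronglyMeasurable
  · refine Filter.Eventually.of_forall fun x hx s hs' => ?_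
    rw [Set.uIoc_of_le (by norm_num)] at hx
    have hx' : x ∈ Set.Icc (-1 : ℝ) 1 := ⟨hx.1.le, hx.2⟩
    have h1 := weight_div_le hα (by linarith [hs s hs'] : 0 < s) hx'
    have h2 : 1 / s ≤ 2 / t := by
      rw [div_le_div_iff₀ (by linarith [hs s hs']) ht]; linarith [hs s hs']
    rw [norm_mul, norm_neg, Real.norm_of_nonneg (weight_div_nonneg hx'), norm_pow]
    have h3 : ‖x‖ ^ k ≤ 1 := pow_le_one₀ (norm_nonneg _) (abs_le.2 hx')
    calc ‖x‖ ^ k * (weight α s x / (1 - x ^ 2)) ≤ 1 * (2 / t) :=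
          mul_le_mul h3 (h1.trans h2) (weight_div_nonneg hx') zero_le_one
      _ = 2 / t := one_mul _
  · exact intervalIntegrable_const
  · exact Filter.Eventually.of_forall fun x _ s _ => (hasDerivAt_weight α s x).const_mul _

/-- Integration against `w`. -/
def weightFunctional (α t : ℝ) : ℝ[X] →ₗ[ℝ] ℝ := momentFunctional fun k => moment α k t

/-- Integration against `w / (1 - x²)`. -/
def divFunctional (α t : ℝ) : ℝ[X] →ₗ[ℝ] ℝ := momentFunctional fun k => divMoment α k t

lemma weightFunctional_apply (hα : 0 < α) (ht : 0 < t) (p : ℝ[X]) :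
    weightFunctional α t p = ∫ x in (-1 : ℝ)..1, p.eval x * weight α t x :=
  momentFunctional_eq_integral (intervalIntegrable_weight hα ht) p

lemma divFunctional_apply (hα : 0 < α) (ht : 0 < t) (p : ℝ[X]) :
    divFunctional α t p = ∫ x in (-1 : ℝ)..1, p.eval x * (weight α t x / (1 - x ^ 2)) :=
  momentFunctional_eq_integral (intervalIntegrable_weight_div hα ht) p

lemma hasDerivAt_weightFunctional (hα : 0 < α) (ht : 0 < t) (p : ℝ[X]) :
    HasDerivAt (fun s => weightFunctional α s p) (-divFunctional α t p) t := by
  simp only [weightFunctional, divFunctional, momentFunctional_apply, ← Finset.sum_neg_distrib,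
    ← mul_neg]
  exact HasDerivAt.fun_sum fun i _ => (hasDerivAt_moment hα i ht).const_mul _

lemma weightFunctional_comp_neg (hα : 0 < α) (ht : 0 < t) (p : ℝ[X]) :
    weightFunctional α t (p.comp (-X)) = weightFunctional α t p := by
  rw [weightFunctional_apply hα ht, weightFunctional_apply hα ht]
  have h := intervalIntegral.integral_comp_neg (a := -1) (b := 1)
    fun x => p.eval x * weight α t x
  rw [neg_neg] at h
  rw [← h]
  simp [weight]

lemma weightFunctional_sq_pos (hα : 0 < α) (ht : 0 < t) {p : ℝ[X]} (hp : p ≠ 0) :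
    0 < weightFunctional α t (p ^ 2) := by
  rw [weightFunctional_apply hα ht, intervalIntegral.integral_of_le (by norm_num)]
  have hint : IntegrableOn (fun x => (p ^ 2).eval x * weight α t x) (Set.Ioc (-1) 1) := by
    rw [← intervalIntegrable_iff_integrableOn_Ioc_of_le (by norm_num)]
    exact (intervalIntegrable_weight hα ht).continuousOn_mul (p ^ 2).continuousOn
  have hnn : 0 ≤ᵐ[volume.restrict (Set.Ioc (-1) 1)] fun x => (p ^ 2).eval x * weight α t x := by
    refine (ae_restrict_iff' measurableSet_Ioc).2 (Filter.Eventually.of_forall fun x hx => ?_)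
    simp only [Pi.zero_apply, eval_pow]
    exact mul_nonneg (sq_nonneg _) (weight_nonneg ⟨hx.1.le, hx.2⟩)
  rw [setIntegral_pos_iff_support_of_nonneg_ae hnn hint]
  -- The integrand is positive off the finitely many roots of `p`.
  have hsub : Set.Ioo (-1 : ℝ) 1 \ (p.roots.toFinset : Set ℝ) ⊆
      (Function.support fun x => (p ^ 2).eval x * weight α t x) ∩ Set.Ioc (-1) 1 := by
    rintro x ⟨hx, hr⟩
    refine ⟨?_, hx.1, hx.2.le⟩
    have h0 : p.eval x ≠ 0 := fun h0 => hr (by simp [hp, IsRoot, h0])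
    rw [Function.mem_support, eval_pow]
    exact mul_ne_zero (pow_ne_zero _ h0) (weight_pos hx).ne'
  refine lt_of_lt_of_le ?_ (measure_mono hsub)
  rw [measure_sdiff_null (Finset.measure_zero _ _)]
  simp

lemma divFunctional_one_sub_sq_mul (hα : 0 < α) (ht : 0 < t) (p : ℝ[X]) :
    divFunctional α t ((1 - X ^ 2) * p) = weightFunctional α t p := by
  rw [weightFunctional_apply hα ht, divFunctional_apply hα ht]
  congr 1
  funext x
  simp only [eval_mul, eval_sub, eval_one, eval_pow, eval_X]
  by_cases hx : 1 - x ^ 2 = 0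
  · rw [weight_eq_zero hα hx]; simp
  · field_simp

/-- The Pearson equation: the factor `1 - x²` leaves a single division by `1 - x²`, which `K`
accounts for. -/
lemma hasDerivAt_one_sub_sq_mul_weight {x : ℝ} (hx : x ∈ Set.Ioo (-1 : ℝ) 1) :
    HasDerivAt (fun x => (1 - x ^ 2) * weight α t x)
      (-(2 + 2 * α) * x * weight α t x - 2 * t * x * (weight α t x / (1 - x ^ 2))) x := by
  have hb := one_sub_sq_pos hx
  have h1 : HasDerivAt (fun x : ℝ => 1 - x ^ 2) (-(2 * x)) x := by
    simpa using (hasDerivAt_pow 2 x).const_sub 1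
  have h2 := h1.rpow_const (p := α) (Or.inl hb.ne')
  have h3 := ((hasDerivAt_const x (-t)).fun_div h1 hb.ne').exp
  refine (h1.fun_mul (h2.fun_mul h3)).congr_deriv ?_
  rw [Real.rpow_sub_one hb.ne', weight]
  field_simp
  ring

lemma continuousOn_one_sub_sq_mul_weight (hα : 0 < α) (ht : 0 < t) :
    ContinuousOn (fun x => (1 - x ^ 2) * weight α t x) (Set.Icc (-1) 1) := by
  intro x hx
  rcases (one_sub_sq_nonneg hx).eq_or_lt with hb | hb
  · have h1 : Filter.Tendsto (fun x : ℝ => 1 - x ^ 2) (nhdsWithin x (Set.Icc (-1) 1))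
        (nhds 0) := by
      have : Continuous fun x : ℝ => 1 - x ^ 2 := by fun_prop
      have h := this.continuousWithinAt (s := Set.Icc (-1) 1) (x := x)
      rwa [ContinuousWithinAt, ← hb] at h
    rw [ContinuousWithinAt, ← hb, zero_mul]
    refine squeeze_zero' ?_ ?_ h1
    · filter_upwards [self_mem_nhdsWithin] with y hy
      exact mul_nonneg (one_sub_sq_nonneg hy) (weight_nonneg hy)
    · filter_upwards [self_mem_nhdsWithin] with y hy
      exact mul_le_of_le_one_right (one_sub_sq_nonneg hy) (weight_le_one hα ht hy)
  · exact (hasDerivAt_one_sub_sq_mul_weight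
      ⟨by nlinarith, by nlinarith⟩).continuousAt.continuousWithinAt

lemma weightFunctional_parts (hα : 0 < α) (ht : 0 < t) (q : ℝ[X]) :
    weightFunctional α t ((1 - X ^ 2) * derivative q) =
      (2 + 2 * α) * weightFunctional α t (X * q) + 2 * t * divFunctional α t (X * q) := by
  rw [weightFunctional_apply hα ht, weightFunctional_apply hα ht, divFunctional_apply hα ht]
  have i1 : ∀ p : ℝ[X], IntervalIntegrable (fun x => p.eval x * weight α t x) volume (-1) 1 :=
    fun p => (intervalIntegrable_weight hα ht).continuousOn_mul p.continuousOn
  have i2 := (intervalIntegrable_weight_div hα ht).continuousOn_mul (X * q).continuousOn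
  have hd : ∀ x ∈ Set.Ioo (-1 : ℝ) 1, HasDerivAt (fun x => q.eval x * ((1 - x ^ 2) * weight α t x))
      (((1 - X ^ 2) * derivative q).eval x * weight α t x
        - (2 + 2 * α) * ((X * q).eval x * weight α t x)
        - 2 * t * ((X * q).eval x * (weight α t x / (1 - x ^ 2)))) x := fun x hx => by
    refine ((q.hasDerivAt x).fun_mul (hasDerivAt_one_sub_sq_mul_weight hx)).congr_deriv ?_
    simp only [eval_mul, eval_sub, eval_one, eval_pow, eval_X]
    ring
  have h := intervalIntegral.integral_eq_sub_of_hasDerivAt_of_le (by norm_num)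
    (q.continuousOn.mul (continuousOn_one_sub_sq_mul_weight hα ht)) hd
    (((i1 _).sub ((i1 _).const_mul _)).sub (i2.const_mul _))
  rw [intervalIntegral.integral_sub ((i1 _).sub ((i1 _).const_mul _)) (i2.const_mul _),
    intervalIntegral.integral_sub (i1 _) ((i1 _).const_mul _),
    intervalIntegral.integral_const_mul, intervalIntegral.integral_const_mul] at h
  norm_num at h
  simp only [eval_mul, eval_sub, eval_one, eval_pow, eval_X] at h ⊢
  linarith

lemma isSemiclassical (hα : 0 < α) (ht : 0 < t) :
    IsSemiclassical α t (weightFunctional α t) (divFunctional α t) where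
  even := weightFunctional_comp_neg hα ht
  pos _ := weightFunctional_sq_pos hα ht
  one_sub_sq := divFunctional_one_sub_sq_mul hα ht
  parts := weightFunctional_parts hα ht

end Weight

/-! ### Hankel determinants and norms. -/

variable {α t : ℝ}

lemma weightFunctional_mul (p q : ℝ[X]) {n : ℕ} (hp : p.natDegree < n) (hq : q.natDegree < n) :
    weightFunctional α t (p * q) =
      ∑ i : Fin n, ∑ j : Fin n, p.coeff i * moment α (i + j) t * q.coeff j := by
  conv_lhs => rw [p.as_sum_range' n hp, q.as_sum_range' n hq]
  rw [Finset.sum_range, Finset.sum_range, Finset.sum_mul_sum, map_sum]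
  refine Finset.sum_congr rfl fun i _ => ?_
  rw [map_sum]
  refine Finset.sum_congr rfl fun j _ => ?_
  rw [monomial_mul_monomial, ← C_mul_X_pow_eq_monomial, map_C_mul, weightFunctional,
    momentFunctional_X_pow]
  ring

/-- The unitriangular matrix `U` of coefficients of the `P_i` diagonalises the Hankel matrix by
congruence. -/
lemma hankelDet_eq_prod (hα : 0 < α) (ht : 0 < t) (n : ℕ) :
    hankelDet α n t = ∏ j ∈ Finset.range n, sqNorm (weightFunctional α t) j := by
  have S := isSemiclassical hα ht
  set L := weightFunctional α t
  set U : Matrix (Fin n) (Fin n) ℝ := Matrix.of fun i j => (orthoPoly L i).coeff j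
  set H : Matrix (Fin n) (Fin n) ℝ := Matrix.of fun i j => moment α ((i : ℕ) + (j : ℕ)) t
  have hU : U.det = 1 := by
    rw [Matrix.det_of_isLowerTriangular U fun i j hij => coeff_orthoPoly_of_lt L hij]
    exact Finset.prod_eq_one fun i _ => coeff_orthoPoly_self L i
  have hUH : U * H * U.transpose = Matrix.diagonal fun i : Fin n => sqNorm L i := by
    ext i k
    have e : (U * H * U.transpose) i k = L (orthoPoly L i * orthoPoly L k) := by
      rw [weightFunctional_mul _ _ ((natDegree_orthoPoly_le L i).trans_lt i.2)
        ((natDegree_orthoPoly_le L k).trans_lt k.2)]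
      simp only [Matrix.mul_apply, Finset.sum_mul, Matrix.transpose_apply]
      rw [Finset.sum_comm]
      rfl
    rw [e, Matrix.diagonal_apply]
    split_ifs with h
    · rw [h, ← sq, sqNorm]
    · rcases lt_or_gt_of_ne (Fin.val_ne_of_ne h) with h | h
      · rw [mul_comm]; exact S.orthogonal _ _ h
      · exact S.orthogonal _ _ h
  have h := congrArg Matrix.det hUH
  rw [Matrix.det_mul, Matrix.det_mul, Matrix.det_transpose, hU, Matrix.det_diagonal, one_mul,
    mul_one] at h
  rw [Finset.prod_range]
  exact h

lemma hankelDet_pos (hα : 0 < α) (ht : 0 < t) (n : ℕ) : 0 < hankelDet α n t := by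
  rw [hankelDet_eq_prod hα ht]
  exact Finset.prod_pos fun j _ => (isSemiclassical hα ht).sqNorm_pos j

lemma differentiableAt_hankelDet (hα : 0 < α) (ht : 0 < t) (n : ℕ) :
    DifferentiableAt ℝ (hankelDet α n) t := by
  have h : DifferentiableAt ℝ
      (fun s => ∏ j ∈ Finset.range n, sqNorm (weightFunctional α s) j) t :=
    DifferentiableAt.fun_finsetProd fun j _ => (hasDerivAt_sqNorm
      (hasDerivAt_weightFunctional hα ht) (isSemiclassical hα ht) j).differentiableAt
  refine h.congr_of_eventuallyEq ?_
  filter_upwards [lt_mem_nhds ht] with s hs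
  exact hankelDet_eq_prod hα hs n

lemma sigma_eq_auxSigma (hα : 0 < α) (ht : 0 < t) (n : ℕ) :
    sigma α n t = auxSigma t (weightFunctional α t) (divFunctional α t) n := by
  have S := isSemiclassical hα ht
  have h : HasDerivAt (fun s => ∑ j ∈ Finset.range n, Real.log (sqNorm (weightFunctional α s) j))
      (∑ j ∈ Finset.range n, -divFunctional α t (orthoPoly (weightFunctional α t) j ^ 2) /
        sqNorm (weightFunctional α t) j) t :=
    HasDerivAt.fun_sum fun j _ => (hasDerivAt_sqNorm
      (hasDerivAt_weightFunctional hα ht) S j).log (S.sqNorm_pos j).ne'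
  have e : (fun s => Real.log (hankelDet α n s)) =ᶠ[nhds t]
      fun s => ∑ j ∈ Finset.range n, Real.log (sqNorm (weightFunctional α s) j) := by
    filter_upwards [lt_mem_nhds ht] with s hs
    rw [hankelDet_eq_prod hα hs, Real.log_prod]
    exact fun j _ => ((isSemiclassical hα hs).sqNorm_pos j).ne'
  rw [sigma, e.deriv_eq, h.deriv, auxSigma, Finset.mul_sum, ← Finset.sum_neg_distrib]
  refine Finset.sum_congr rfl fun j _ => ?_
  rw [auxX]
  ring

end

end PollaczekJacobi

/-! ### The main theorem. -/

theorem mainTheorem5 (α : ℝ) (hα : 0 < α) :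
    -- `D_n` is positive and differentiable on `(0, ∞)`, so `σ_n` is well defined there
    (∀ (n : ℕ) (t : ℝ), 0 < t →
      0 < PollaczekJacobi.hankelDet α n t ∧
      DifferentiableAt ℝ (PollaczekJacobi.hankelDet α n) t) ∧
    -- `σ_n` is twice differentiable on `(0, ∞)` and satisfies the differential equation
    (∀ (n : ℕ) (t : ℝ), 0 < t →
      DifferentiableAt ℝ (PollaczekJacobi.sigma α n) t ∧
      DifferentiableAt ℝ (deriv (PollaczekJacobi.sigma α n)) t ∧
      PollaczekJacobi.SatisfiesODE (n : ℝ) α t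
        (PollaczekJacobi.sigma α n t)
        (deriv (PollaczekJacobi.sigma α n) t)
        (deriv (deriv (PollaczekJacobi.sigma α n)) t)) ∧
    -- the difference equation in `n`
    (∀ (n : ℕ) (t : ℝ), 1 ≤ n → 0 < t →
      PollaczekJacobi.SatisfiesDifferenceEq (n : ℝ) α t
        (PollaczekJacobi.sigma α (n - 1) t)
        (PollaczekJacobi.sigma α n t)
        (PollaczekJacobi.sigma α (n + 1) t)) := by
  open PollaczekJacobi in
  refine ⟨fun n t ht => ⟨hankelDet_pos hα ht n, differentiableAt_hankelDet hα ht n⟩,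
    fun n t ht => ?_, fun n t hn ht => ?_⟩
  · obtain ⟨h1, h2, h3⟩ := satisfiesODE_auxSigma (fun s hs => isSemiclassical hα hs)
      (fun s hs => hasDerivAt_weightFunctional hα hs) ht n
    -- The two functions are identified only for positive arguments, so derivatives are transferred
    -- through equality near `t`.
    have e : sigma α n =ᶠ[nhds t]
        fun s => auxSigma s (weightFunctional α s) (divFunctional α s) n := by
      filter_upwards [lt_mem_nhds ht] with s hs
      exact sigma_eq_auxSigma hα hs n
    rw [← e.deriv.deriv_eq, ← e.deriv_eq, ← e.eq_of_nhds] at h3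
    exact ⟨h1.congr_of_eventuallyEq e, h2.congr_of_eventuallyEq e.deriv, h3⟩
  · obtain ⟨n, rfl⟩ : ∃ k, n = k + 1 := ⟨n - 1, by omega⟩
    rw [Nat.add_sub_cancel, sigma_eq_auxSigma hα ht, sigma_eq_auxSigma hα ht,
      sigma_eq_auxSigma hα ht]
    exact (isSemiclassical hα ht).satisfiesDifferenceEq n
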